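/- For a meromorphic function $f$ on $\mathbb{C}$ let $T(r,f)=m(r,f)+N(r,f)$ denote its Nevanlinna characteristic. Let $\omega(z)=cz^n+p_{n-1}z^{n-1}+\cdots+p_0$ be a polynomial with complex coefficients, $n\ge 1$ and $c\neq 0$. If $f$ is a meromorphic function on $\mathbb{C}$ whose hyper-order satisfies $$\limsup_{r\to\infty}\frac{\log\log T(r,f)}{\log r}<\frac{1}{n^2}$$ (for constant $f$ the left-hand side is understood to be $0$), then there is a set $E\subset\mathbb{R}$ of finite logarithmic measure, i.e. $\int_{E\cap[1,\infty)}\frac{dt}{t}<\infty$, such that $$T(r,f\circ\omega)=(1+o(1))\,T(|c|r^n,f)\qquad\text{as } r\to\infty,\ r\notin E.$$ -/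

import Mathlib

open Filter Topology

/-- The Nevanlinna characteristic `T(r, f) = m(r, f) + N(r, f)` of a meromorphic function on `ℂ`,
where `m` is the proximity function and `N` the integrated counting function of the poles. -/
noncomputable def nevanlinnaT (r : ℝ) (f : ℂ → ℂ) : ℝ :=
  ValueDistribution.characteristic f ⊤ r

/-- The hyper-order `limsup_{r → ∞} log log T(r, f) / log r`, as an extended real number.
For non-constant `f` one has `T(r, f) → ∞`, so both positive parts may be dropped for large `r`;
they only give the usual meaning (hyper-order `0`) to the expression when `f` is constant. -/
noncomputable def hyperOrder (f : ℂ → ℂ) : EReal :=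
  limsup (fun r : ℝ =>
    ((Real.posLog (Real.posLog (nevanlinnaT r f)) / Real.log r : ℝ) : EReal)) atTop

/-- `E` is measurable and `∫_{E ∩ [1, ∞)} dt / t < ∞`. -/
def FiniteLogMeasure (E : Set ℝ) : Prop :=
  MeasurableSet E ∧ ∫⁻ t in E ∩ Set.Ici 1, ENNReal.ofReal (1 / t) < ⊤

/-! ### Moduli of the preimages of a point under a polynomial -/

section Polynomial

open Polynomial

/-! By Cartan's formula, increments of `T(r, f)` are averages over `|a| = 1` of increments of `N(r,
a, f)`, so it suffices to compare counting functions of `a`-points. The `a`-points of `f ∘ ω` are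
the preimages of those of `f`. If `|z| = |c| s ^ n`, the `n` preimages of `z` have moduli within a
fixed `C` of `s`. Hence, beyond a radius depending on `ε`, the increments of `T(r, f ∘ ω)` and of
`S(r) = T(|c| r ^ n, f)` dominate each other up to a factor `1 + ε` and a shift of `r` by `C`
(`characteristic_comp_polynomial_bounds`).

It remains to see that `S(r ± C) ~ S(r)`. The hyper-order bound gives `log S(r) = O(r ^ κ)` with `κ
< 1`. A monotone function of such growth has vanishing increments over intervals of bounded length,
outside a set of finite logarithmic measure (`exists_finiteLogMeasure_tendsto_shift_sub_shift`). A
squeeze then finishes the proof (`tendsto_div_of_shift_bounds`). Constant `f` is treated apart,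
since the squeeze needs `S → ∞`. -/

theorem Polynomial.norm_eval_eq_norm_leadingCoeff_mul_prod_roots (p : ℂ[X]) (w : ℂ) :
    ‖p.eval w‖ = ‖p.leadingCoeff‖ * (p.roots.map fun a => ‖w - a‖).prod := by
  conv_lhs => rw [(IsAlgClosed.splits p).eq_prod_roots]
  rw [eval_mul, eval_C, norm_mul, eval_multiset_prod, Multiset.map_map]
  congr 1
  refine (map_multiset_prod (normHom : ℂ →*₀ ℝ) _).trans ?_
  rw [Multiset.map_map]
  simp [Function.comp_def]

/-- Up to a bounded error, `‖p w‖ = ‖c‖ s ^ n` forces `s = ‖w‖`. -/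
theorem Polynomial.exists_abs_norm_sub_le (p : ℂ[X]) (hp : 1 ≤ p.natDegree) :
    ∃ C : ℝ, 0 < C ∧ ∀ (w : ℂ) (s : ℝ), 0 ≤ s →
      ‖p.eval w‖ = ‖p.leadingCoeff‖ * s ^ p.natDegree → s ≤ ‖w‖ + C ∧ ‖w‖ ≤ s + C := by
  have hp0 : p ≠ 0 := by rintro rfl; simp at hp
  have hc : 0 < ‖p.leadingCoeff‖ := by simpa using hp0
  obtain ⟨C, hC0, hC⟩ : ∃ C : ℝ, 0 < C ∧ ∀ a ∈ p.roots, ‖a‖ ≤ C := by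
    refine ⟨1 + ∑ a ∈ p.roots.toFinset, ‖a‖, by positivity, fun a ha => ?_⟩
    have := Finset.single_le_sum (f := fun a : ℂ => ‖a‖) (fun _ _ => norm_nonneg _)
      (Multiset.mem_toFinset.2 ha)
    linarith
  have hcard : p.roots.card = p.natDegree :=
    splits_iff_card_roots.1 (IsAlgClosed.splits p)
  refine ⟨C, hC0, fun w s hs h => ?_⟩
  rw [p.norm_eval_eq_norm_leadingCoeff_mul_prod_roots] at h
  have h' := mul_left_cancel₀ hc.ne' h
  constructor
  -- `s ^ n` is the product of the `n` distances from `w` to the roots, each between `‖w‖ - C` and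
  -- `‖w‖ + C`.
  · have : s ^ p.natDegree ≤ (‖w‖ + C) ^ p.natDegree := by
      rw [← h', ← hcard]
      refine (Multiset.prod_map_le_prod_map₀ _ (fun _ => ‖w‖ + C) (fun _ _ => norm_nonneg _)
        fun a ha => ?_).trans (by simp)
      exact (norm_sub_le _ _).trans (by gcongr; exact hC a ha)
    exact le_of_pow_le_pow_left₀ (by omega) (by positivity) this
  · rcases le_total ‖w‖ C with hw | hw
    · linarith
    have : (‖w‖ - C) ^ p.natDegree ≤ s ^ p.natDegree := by
      rw [← h', ← hcard]
      refine le_trans (by simp) (Multiset.prod_map_le_prod_map₀ (fun _ => ‖w‖ - C) _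
        (fun _ _ => by linarith) fun a ha => ?_)
      have := norm_sub_norm_le w a
      have := hC a ha
      linarith
    have := le_of_pow_le_pow_left₀ (by omega) hs this
    linarith

end Polynomial

/-! ### Truncated logarithms under bounded shifts -/

section TruncatedLog

/-- The contribution `∫ t in [r₁, r₂] ∩ [x, ∞), dt / t` of a point of modulus `x` to the growth of
the integrated counting function from radius `r₁` to radius `r₂`. -/
noncomputable def truncLog (r₁ r₂ x : ℝ) : ℝ := Real.log (max r₂ x) - Real.log (max r₁ x)

theorem truncLog_antitone {r₁ r₂ : ℝ} (h₁ : 0 < r₁) (h : r₁ ≤ r₂) :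
    Antitone (truncLog r₁ r₂) := by
  intro x y hxy
  have h2 := h₁.trans_le h
  have p : ∀ z, 0 < max r₁ z := fun z => lt_max_of_lt_left h₁
  have q : ∀ z, 0 < max r₂ z := fun z => lt_max_of_lt_left h2
  unfold truncLog
  rw [← Real.log_div (q _).ne' (p _).ne', ← Real.log_div (q _).ne' (p _).ne']
  refine Real.log_le_log (div_pos (q _) (p _)) ?_
  rw [div_le_div_iff₀ (p _) (p _)]
  rcases le_total r₂ x with hx | hx
  · rw [max_eq_right hx, max_eq_right (hx.trans hxy), max_eq_right (h.trans hx),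
      max_eq_right (h.trans (hx.trans hxy)), mul_comm]
  rcases le_total r₂ y with hy | hy
  · rw [max_eq_left hx, max_eq_right hy, max_eq_right (h.trans hy), mul_comm]
    exact mul_le_mul_of_nonneg_right (max_le h hx) (h2.le.trans hy)
  · rw [max_eq_left hx, max_eq_left hy]
    gcongr

/-- Bernoulli's inequality with exponent `1 + ε`, applied to `(x + C) / (y + C) = 1 + (x - y) / (y +
C)`. The condition `C ≤ ε y` says that `y + C ≤ (1 + ε) y`. -/
theorem log_sub_log_le_mul_log_add_sub_log_add {x y C ε : ℝ} (hC : 0 ≤ C) (hy : 0 < y)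
    (hxy : y ≤ x) (hε : 0 ≤ ε) (hCy : C ≤ ε * y) :
    Real.log x - Real.log y ≤ (1 + ε) * (Real.log (x + C) - Real.log (y + C)) := by
  have hx : 0 < x := hy.trans_le hxy
  have hyC : 0 < y + C := by positivity
  have hxC : 0 < x + C := by positivity
  rw [← Real.log_div hx.ne' hy.ne', ← Real.log_div hxC.ne' hyC.ne',
    ← Real.log_rpow (div_pos hxC hyC)]
  refine Real.log_le_log (div_pos hx hy) ?_
  have hs : (0 : ℝ) ≤ (x - y) / (y + C) := div_nonneg (by linarith) hyC.le
  have key := one_add_mul_self_le_rpow_one_add (s := (x - y) / (y + C)) (p := 1 + ε)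
    (by linarith) (by linarith)
  have e : 1 + (x - y) / (y + C) = (x + C) / (y + C) := by field_simp; ring
  rw [e] at key
  refine le_trans ?_ key
  have : (x - y) / y ≤ (1 + ε) * ((x - y) / (y + C)) := by
    rw [← mul_div_assoc, div_le_div_iff₀ hy hyC]
    nlinarith
  have e2 : x / y = 1 + (x - y) / y := by field_simp; ring
  linarith

/-- Shifting both radii by `C` absorbs the one-sided error in `s ≤ t + C`. It serves both directions
of the comparison, with `s` and `t` exchanged. -/
theorem truncLog_le_mul_truncLog_add {r₁ r₂ s t C ε : ℝ} (h₁ : 0 < r₁) (h : r₁ ≤ r₂)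
    (hC : 0 ≤ C) (hε : 0 ≤ ε) (hCr : C ≤ ε * r₁) (hst : s ≤ t + C) :
    truncLog r₁ r₂ t ≤ (1 + ε) * truncLog (r₁ + C) (r₂ + C) s := by
  have h1 := truncLog_antitone (r₁ := r₁ + C) (r₂ := r₂ + C) (by linarith) (by linarith) hst
  have h2 := log_sub_log_le_mul_log_add_sub_log_add (x := max r₂ t) (y := max r₁ t) hC
    (lt_max_of_lt_left h₁) (max_le_max_right _ h) hε
    (hCr.trans (mul_le_mul_of_nonneg_left (le_max_left _ _) hε))
  rw [← max_add_add_right, ← max_add_add_right] at h2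
  exact h2.trans (mul_le_mul_of_nonneg_left h1 (by linarith))

theorem truncLog_mul_pow {k r₁ r₂ t : ℝ} (n : ℕ) (hk : 0 < k) (h₁ : 0 < r₁) (h₂ : 0 < r₂)
    (ht : 0 ≤ t) :
    truncLog (k * r₁ ^ n) (k * r₂ ^ n) (k * t ^ n) = n * truncLog r₁ r₂ t := by
  have key : ∀ r, 0 < r → Real.log (max (k * r ^ n) (k * t ^ n))
      = Real.log k + n * Real.log (max r t) := by
    intro r hr
    have : max (k * r ^ n) (k * t ^ n) = k * (max r t) ^ n := by
      rcases le_total r t with h | h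
      · rw [max_eq_right h, max_eq_right]; gcongr
      · rw [max_eq_left h, max_eq_left]; gcongr
    rw [this, Real.log_mul hk.ne' (pow_pos (lt_max_of_lt_left hr) n).ne', Real.log_pow]
  rw [truncLog, truncLog, key _ h₁, key _ h₂]
  ring

end TruncatedLog

/-! ### Integrated counting functions as finite sums -/

section Counting

open Function Metric

/-- Points outside the disc contribute zero thanks to the maximum, and the convention `Real.log 0 =
0` makes the origin contribute `D 0 * log r`, so neither needs a separate term. -/
theorem Function.locallyFinsuppWithin.logCounting_eq_sum
    (D : locallyFinsupp ℂ ℤ) {r : ℝ} (hr : 0 < r) {Z : Finset ℂ}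
    (hZ : ∀ z, D z ≠ 0 → ‖z‖ ≤ r → z ∈ Z) :
    locallyFinsuppWithin.logCounting D r
      = ∑ z ∈ Z, D z * (Real.log (max r ‖z‖) - Real.log ‖z‖) := by
  have hball : ∀ z : ℂ, z ∈ closedBall (0 : ℂ) |r| ↔ ‖z‖ ≤ r := by
    intro z; simp [abs_of_pos hr]
  simp only [locallyFinsuppWithin.logCounting, AddMonoidHom.coe_mk, ZeroHom.coe_mk]
  have hsupp : (Function.support fun z => ((locallyFinsuppWithin.toClosedBall r D z : ℤ) : ℝ)
      * Real.log (r * ‖z‖⁻¹)) ⊆ Z := by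
    intro z hz
    have h0 : locallyFinsuppWithin.toClosedBall r D z ≠ 0 := by
      intro h; simp [h] at hz
    have hzb := locallyFinsuppWithin.toClosedBall_support_subset_closedBall D h0
    rw [locallyFinsuppWithin.toClosedBall_eval_within _ hzb] at h0
    exact hZ z h0 ((hball z).1 hzb)
  rw [finsum_eq_sum_of_support_subset _ hsupp]
  have h0 : (D 0 : ℝ) * Real.log r = ∑ z ∈ Z, if z = 0 then (D 0 : ℝ) * Real.log r else 0 := by
    rw [Finset.sum_ite_eq']
    split_ifs with h
    · rfl
    · have : D 0 = 0 := by
        by_contra h'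
        exact h (hZ 0 h' (by simpa using hr.le))
      simp [this]
  rw [h0, ← Finset.sum_add_distrib]
  refine Finset.sum_congr rfl fun z _ => ?_
  by_cases hz : z = 0
  · subst hz; simp [hr.le]
  have hzn : ‖z‖ ≠ 0 := by simpa using hz
  simp only [hz, if_false, add_zero]
  by_cases hzb : ‖z‖ ≤ r
  · rw [locallyFinsuppWithin.toClosedBall_eval_within _ ((hball z).2 hzb), max_eq_left hzb,
      ← div_eq_mul_inv, Real.log_div hr.ne' hzn]
  · rw [locallyFinsuppWithin.apply_eq_zero_of_notMem _ (mt (hball z).1 hzb),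
      max_eq_right (not_le.1 hzb).le]
    simp

theorem Function.locallyFinsuppWithin.logCounting_sub_logCounting
    (D : locallyFinsupp ℂ ℤ) {r₁ r₂ : ℝ} (h₁ : 0 < r₁) (h : r₁ ≤ r₂) {Z : Finset ℂ}
    (hZ : ∀ z, D z ≠ 0 → ‖z‖ ≤ r₂ → z ∈ Z) :
    locallyFinsuppWithin.logCounting D r₂ - locallyFinsuppWithin.logCounting D r₁
      = ∑ z ∈ Z, D z * truncLog r₁ r₂ ‖z‖ := by
  rw [logCounting_eq_sum D (h₁.trans_le h) hZ,
    logCounting_eq_sum D h₁ fun z hz hzr => hZ z hz (hzr.trans h), ← Finset.sum_sub_distrib]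
  refine Finset.sum_congr rfl fun z _ => ?_
  rw [truncLog]
  ring

theorem Function.locallyFinsuppWithin.exists_finset_of_norm_le (D : locallyFinsupp ℂ ℤ) (r : ℝ) :
    ∃ Z : Finset ℂ, ∀ z, D z ≠ 0 → ‖z‖ ≤ r → z ∈ Z := by
  have hfin : ((locallyFinsuppWithin.toClosedBall r D).support).Finite :=
    locallyFinsuppWithin.finiteSupport _ (isCompact_closedBall 0 |r|)
  refine ⟨hfin.toFinset, fun z hz hzr => ?_⟩
  have hzb : z ∈ closedBall (0 : ℂ) |r| := by simpa using hzr.trans (le_abs_self r)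
  simpa [locallyFinsuppWithin.toClosedBall_eval_within D hzb] using hz

end Counting

/-! ### Pull-back of divisors under a polynomial -/

section Pullback

open Polynomial Function

/-- Summing over the fibres of a polynomial. -/
theorem Polynomial.exists_finset_sum_comp_eq (p : ℂ[X]) (hp : 1 ≤ p.natDegree)
    (Z : Finset ℂ) :
    ∃ W : Finset ℂ, (∀ w, w ∈ W ↔ p.eval w ∈ Z) ∧ ∀ D F : ℂ → ℝ,
      ∑ w ∈ W, (p - C (p.eval w)).rootMultiplicity w * D (p.eval w) * F w
        = ∑ z ∈ Z, D z * ((p - C z).roots.map F).sum := by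
  classical
  have hne : ∀ z, p - C z ≠ 0 := fun z h => by
    have := natDegree_sub_C (p := p) (a := z)
    simp [h] at this
    omega
  have hmem : ∀ w z, w ∈ (p - C z).roots.toFinset ↔ p.eval w = z := by
    intro w z
    simp [hne z, sub_eq_zero]
  refine ⟨Z.biUnion fun z => (p - C z).roots.toFinset, fun w => ?_, fun D F => ?_⟩
  · simp only [Finset.mem_biUnion, hmem]
    exact ⟨fun ⟨z, hz, h⟩ => h ▸ hz, fun h => ⟨_, h, rfl⟩⟩
  rw [Finset.sum_biUnion]
  · refine Finset.sum_congr rfl fun z _ => ?_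
    rw [Finset.sum_multiset_map_count, Finset.mul_sum]
    refine Finset.sum_congr rfl fun w hw => ?_
    rw [(hmem w z).1 hw, count_roots, nsmul_eq_mul]
    ring
  · intro z _ z' _ hzz'
    refine Finset.disjoint_left.2 fun w hw hw' => hzz' ?_
    rw [← (hmem w z).1 hw, ← (hmem w z').1 hw']

theorem Polynomial.exists_norm_eq_norm_leadingCoeff_mul_pow (p : ℂ[X]) (hp : 1 ≤ p.natDegree)
    (z : ℂ) : ∃ s : ℝ, 0 ≤ s ∧ ‖z‖ = ‖p.leadingCoeff‖ * s ^ p.natDegree := by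
  have hp0 : p ≠ 0 := by rintro rfl; simp at hp
  have hc : 0 < ‖p.leadingCoeff‖ := by simpa using hp0
  refine ⟨(‖z‖ / ‖p.leadingCoeff‖) ^ ((p.natDegree : ℝ)⁻¹), by positivity, ?_⟩
  rw [Real.rpow_inv_natCast_pow (by positivity) (by omega)]
  field_simp

/-- The integrated counting functions of an effective divisor and of its pull-back under a
polynomial of degree `n` and leading coefficient `c` grow alike, up to replacing `r` by `‖c‖ r ^ n`
and a bounded shift of `r`. -/
theorem Polynomial.logCounting_pullback_bounds (p : ℂ[X]) (hp : 1 ≤ p.natDegree) {K : ℝ}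
    (hK0 : 0 < K) (hK : ∀ (w : ℂ) (s : ℝ), 0 ≤ s →
      ‖p.eval w‖ = ‖p.leadingCoeff‖ * s ^ p.natDegree → s ≤ ‖w‖ + K ∧ ‖w‖ ≤ s + K)
    {D D' : locallyFinsupp ℂ ℤ} (hD : 0 ≤ D)
    (hD' : ∀ w, D' w = (p - C (p.eval w)).rootMultiplicity w * D (p.eval w))
    {r₁ r₂ ε : ℝ} (h₁ : 0 < r₁) (h : r₁ ≤ r₂) (hε : 0 ≤ ε) (hKr : K ≤ ε * r₁) :
    locallyFinsuppWithin.logCounting D' r₂ - locallyFinsuppWithin.logCounting D' r₁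
        ≤ (1 + ε) * (locallyFinsuppWithin.logCounting D (‖p.leadingCoeff‖ * (r₂ + K) ^ p.natDegree)
          - locallyFinsuppWithin.logCounting D (‖p.leadingCoeff‖ * (r₁ + K) ^ p.natDegree)) ∧
      locallyFinsuppWithin.logCounting D (‖p.leadingCoeff‖ * r₂ ^ p.natDegree)
          - locallyFinsuppWithin.logCounting D (‖p.leadingCoeff‖ * r₁ ^ p.natDegree)
        ≤ (1 + ε) * (locallyFinsuppWithin.logCounting D' (r₂ + K)
          - locallyFinsuppWithin.logCounting D' (r₁ + K)) := by
  have hp0 : p ≠ 0 := by rintro rfl; simp at hp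
  have hc : 0 < ‖p.leadingCoeff‖ := by simpa using hp0
  have h₂ : 0 < r₂ := h₁.trans_le h
  set n := p.natDegree with hn
  set k := ‖p.leadingCoeff‖ with hk
  -- One `K` is for the shifted radius `r₂ + K` and one for the error in the moduli of preimages, so
  -- that the preimage `W` of `Z` captures all of `D'` up to `r₂ + K`.
  obtain ⟨Z, hZ⟩ := locallyFinsuppWithin.exists_finset_of_norm_le D (k * (r₂ + 2 * K) ^ n)
  obtain ⟨W, hW, hsum⟩ := p.exists_finset_sum_comp_eq hp Z
  have hZr : ∀ r, 0 ≤ r → r ≤ r₂ + 2 * K → ∀ z, D z ≠ 0 → ‖z‖ ≤ k * r ^ n → z ∈ Z :=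
    fun r hr0 hr z hz hzr => hZ z hz (hzr.trans (by gcongr))
  have hWr : ∀ r, r ≤ r₂ + K → ∀ w, D' w ≠ 0 → ‖w‖ ≤ r → w ∈ W := by
    intro r hr w hw hwr
    rw [hW]
    obtain ⟨s, hs0, hs⟩ := p.exists_norm_eq_norm_leadingCoeff_mul_pow hp (p.eval w)
    refine hZr s hs0 ?_ _ (fun h0 => hw (by simp [hD', h0])) hs.le
    linarith [(hK w s hs0 hs).1]
  have hroots : ∀ z, (p - C z).roots.card = n := fun z => by
    rw [splits_iff_card_roots.1 (IsAlgClosed.splits _), natDegree_sub_C]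
  have hne : ∀ z, p - C z ≠ 0 := fun z h => by
    have := natDegree_sub_C (p := p) (a := z)
    simp [h] at this
    omega
  have heval : ∀ z, ∀ w ∈ (p - C z).roots, p.eval w = z := fun z w hw => by
    simpa [hne z, sub_eq_zero] using hw
  have hsum' : ∀ F : ℂ → ℝ, ∑ w ∈ W, D' w * F w
      = ∑ z ∈ Z, D z * ((p - C z).roots.map F).sum := by
    intro F
    rw [← hsum (fun z => D z) F]
    refine Finset.sum_congr rfl fun w _ => ?_
    rw [hD']
    push_cast
    rfl
  have hDz : ∀ z, (0 : ℝ) ≤ D z := fun z => by exact_mod_cast hD z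
  constructor
  · rw [locallyFinsuppWithin.logCounting_sub_logCounting D' h₁ h (hWr r₂ (by linarith)),
      locallyFinsuppWithin.logCounting_sub_logCounting D (by positivity) (by gcongr)
        (hZr (r₂ + K) (by positivity) (by linarith)), hsum', Finset.mul_sum]
    refine Finset.sum_le_sum fun z _ => ?_
    rw [mul_left_comm]
    refine mul_le_mul_of_nonneg_left ?_ (hDz z)
    obtain ⟨s, hs0, hs⟩ := p.exists_norm_eq_norm_leadingCoeff_mul_pow hp z
    -- The factor `n` produced by `r ↦ k r ^ n` matches the number of preimages of `z`, counted with
    -- multiplicity.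
    rw [hs, ← hk, ← hn, truncLog_mul_pow n hc (by positivity) (by positivity) hs0]
    refine (Multiset.sum_le_card_nsmul _
      ((1 + ε) * truncLog (r₁ + K) (r₂ + K) s) fun x hx => ?_).trans (le_of_eq ?_)
    · obtain ⟨w, hw, rfl⟩ := Multiset.mem_map.1 hx
      refine truncLog_le_mul_truncLog_add h₁ h hK0.le hε hKr ?_
      exact (hK w s hs0 (by rw [heval z w hw, hs])).1
    · rw [Multiset.card_map, hroots, nsmul_eq_mul]
      ring
  · rw [locallyFinsuppWithin.logCounting_sub_logCounting D' (by positivity) (by linarith)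
        (hWr (r₂ + K) le_rfl),
      locallyFinsuppWithin.logCounting_sub_logCounting D (by positivity) (by gcongr)
        (hZr r₂ h₂.le (by linarith)), hsum', Finset.mul_sum]
    refine Finset.sum_le_sum fun z _ => ?_
    rw [mul_left_comm (1 + ε)]
    refine mul_le_mul_of_nonneg_left ?_ (hDz z)
    obtain ⟨s, hs0, hs⟩ := p.exists_norm_eq_norm_leadingCoeff_mul_pow hp z
    rw [hs, ← hk, ← hn, truncLog_mul_pow n hc h₁ h₂ hs0, ← Multiset.sum_map_mul_left]
    refine le_trans (le_of_eq ?_) (Multiset.card_nsmul_le_sum (a := truncLog r₁ r₂ s)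
      fun x hx => ?_)
    · rw [Multiset.card_map, hroots, nsmul_eq_mul]
    · obtain ⟨w, hw, rfl⟩ := Multiset.mem_map.1 hx
      refine truncLog_le_mul_truncLog_add h₁ h hK0.le hε hKr ?_
      exact (hK w s hs0 (by rw [heval z w hw, hs])).2

theorem Polynomial.analyticOrderAt_eval_sub (p : ℂ[X]) (hp : 1 ≤ p.natDegree) (w : ℂ) :
    analyticOrderAt (fun x => p.eval x - p.eval w) w
      = ((p - C (p.eval w)).rootMultiplicity w : ℕ) := by
  have hne : p - C (p.eval w) ≠ 0 := fun h => by
    have := natDegree_sub_C (p := p) (a := p.eval w)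
    simp [h] at this
    omega
  obtain ⟨q, hq, hqw⟩ := exists_eq_pow_rootMultiplicity_mul_and_not_dvd _ hne w
  rw [dvd_iff_isRoot] at hqw
  have han : ∀ q : ℂ[X], AnalyticAt ℂ (fun x => q.eval x) w := fun q => by
    simpa using AnalyticAt.aeval_polynomial (f := fun x : ℂ => x) analyticAt_id q
  rw [((han p).fun_sub analyticAt_const).analyticOrderAt_eq_natCast]
  refine ⟨fun x => q.eval x, han q, hqw, Eventually.of_forall fun x => ?_⟩
  have := congrArg (eval x) hq
  simpa using this

theorem Polynomial.not_eventuallyConst_eval (p : ℂ[X]) (hp : 1 ≤ p.natDegree) (w : ℂ) :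
    ¬ EventuallyConst (fun x => p.eval x) (𝓝 w) := by
  rw [eventuallyConst_iff_analyticOrderAt_sub_eq_top, p.analyticOrderAt_eval_sub hp]
  exact ENat.natCast_ne_top _

theorem Polynomial.analyticAt_eval (p : ℂ[X]) (w : ℂ) : AnalyticAt ℂ (fun x => p.eval x) w := by
  simpa using AnalyticAt.aeval_polynomial (f := fun x : ℂ => x) analyticAt_id p

theorem Meromorphic.comp_polynomial {f : ℂ → ℂ} (hf : Meromorphic f) (p : ℂ[X]) :
    Meromorphic fun z => f (p.eval z) :=
  fun w => MeromorphicAt.comp_analyticAt (g := fun x => p.eval x) (hf _) (p.analyticAt_eval w)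

theorem Meromorphic.divisor_comp_polynomial {f : ℂ → ℂ} (hf : Meromorphic f) (p : ℂ[X])
    (hp : 1 ≤ p.natDegree) (h : ∀ z, meromorphicOrderAt f z ≠ ⊤) (w : ℂ) :
    MeromorphicOn.divisor (fun z => f (p.eval z)) Set.univ w
      = (p - C (p.eval w)).rootMultiplicity w
        * MeromorphicOn.divisor f Set.univ (p.eval w) := by
  rw [MeromorphicOn.divisor_apply (hf.comp_polynomial p).meromorphicOn (Set.mem_univ _),
    MeromorphicOn.divisor_apply hf.meromorphicOn (Set.mem_univ _)]
  have := (hf (p.eval w)).meromorphicOrderAt_comp (p.analyticAt_eval w)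
    (p.not_eventuallyConst_eval hp w)
  rw [p.analyticOrderAt_eval_sub hp] at this
  lift meromorphicOrderAt f (p.eval w) to ℤ using h _ with m hm
  change (meromorphicOrderAt (f ∘ fun x => p.eval x) w).untop₀ = _
  rw [this, mul_comm]
  rfl

end Pullback

/-! ### From counting functions to the characteristic -/

section Characteristic

open Polynomial Function ValueDistribution

/-- Cartan's formula; its second term does not depend on the radius and cancels. -/
theorem ValueDistribution.characteristic_sub_characteristic_eq_circleAverage {f : ℂ → ℂ}
    (hf : Meromorphic f) {r₁ r₂ : ℝ} (h₁ : r₁ ≠ 0) (h₂ : r₂ ≠ 0) :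
    characteristic f ⊤ r₂ - characteristic f ⊤ r₁
      = Real.circleAverage (fun a => logCounting f a r₂ - logCounting f a r₁) 0 1 := by
  rw [Real.circleAverage_fun_sub (circleIntegrable_logCounting hf)
      (circleIntegrable_logCounting hf),
    characteristic_top_eq_circleAverage_add_circleAverage hf h₁,
    characteristic_top_eq_circleAverage_add_circleAverage hf h₂]
  ring

theorem ValueDistribution.logCounting_comp_polynomial_bounds {f : ℂ → ℂ} (hf : Meromorphic f)
    (p : ℂ[X]) (hp : 1 ≤ p.natDegree) {K : ℝ}
    (hK0 : 0 < K) (hK : ∀ (w : ℂ) (s : ℝ), 0 ≤ s →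
      ‖p.eval w‖ = ‖p.leadingCoeff‖ * s ^ p.natDegree → s ≤ ‖w‖ + K ∧ ‖w‖ ≤ s + K)
    {a : ℂ} (ha : ∀ z, meromorphicOrderAt (f · - a) z ≠ ⊤)
    {r₁ r₂ ε : ℝ} (h₁ : 0 < r₁) (h : r₁ ≤ r₂) (hε : 0 ≤ ε) (hKr : K ≤ ε * r₁) :
    logCounting (fun z => f (p.eval z)) a r₂ - logCounting (fun z => f (p.eval z)) a r₁
        ≤ (1 + ε) * (logCounting f a (‖p.leadingCoeff‖ * (r₂ + K) ^ p.natDegree)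
          - logCounting f a (‖p.leadingCoeff‖ * (r₁ + K) ^ p.natDegree)) ∧
      logCounting f a (‖p.leadingCoeff‖ * r₂ ^ p.natDegree)
          - logCounting f a (‖p.leadingCoeff‖ * r₁ ^ p.natDegree)
        ≤ (1 + ε) * (logCounting (fun z => f (p.eval z)) a (r₂ + K)
          - logCounting (fun z => f (p.eval z)) a (r₁ + K)) := by
  have hfa : Meromorphic (f · - a) := fun z => (hf z).fun_sub (MeromorphicAt.const a z)
  rw [logCounting_coe, logCounting_coe]
  refine p.logCounting_pullback_bounds hp hK0 hK (posPart_nonneg _) (fun w => ?_) h₁ h hε hKr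
  rw [locallyFinsuppWithin.posPart_apply, locallyFinsuppWithin.posPart_apply,
    hfa.divisor_comp_polynomial p hp ha w]
  set m := MeromorphicOn.divisor (f · - a) Set.univ (p.eval w)
  rcases le_total 0 m with hm | hm
  · rw [posPart_of_nonneg hm, posPart_of_nonneg (by positivity)]
  · rw [posPart_of_nonpos hm, posPart_of_nonpos (mul_nonpos_of_nonneg_of_nonpos (by positivity) hm),
      mul_zero]

theorem ValueDistribution.characteristic_comp_polynomial_bounds {f : ℂ → ℂ} (hf : Meromorphic f)
    (hfc : ∀ a z, meromorphicOrderAt (f · - a) z ≠ ⊤) (p : ℂ[X]) (hp : 1 ≤ p.natDegree) {K : ℝ}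
    (hK0 : 0 < K) (hK : ∀ (w : ℂ) (s : ℝ), 0 ≤ s →
      ‖p.eval w‖ = ‖p.leadingCoeff‖ * s ^ p.natDegree → s ≤ ‖w‖ + K ∧ ‖w‖ ≤ s + K)
    {r₁ r₂ ε : ℝ} (h₁ : 0 < r₁) (h : r₁ ≤ r₂) (hε : 0 ≤ ε) (hKr : K ≤ ε * r₁) :
    characteristic (fun z => f (p.eval z)) ⊤ r₂ - characteristic (fun z => f (p.eval z)) ⊤ r₁
        ≤ (1 + ε) * (characteristic f ⊤ (‖p.leadingCoeff‖ * (r₂ + K) ^ p.natDegree)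
          - characteristic f ⊤ (‖p.leadingCoeff‖ * (r₁ + K) ^ p.natDegree)) ∧
      characteristic f ⊤ (‖p.leadingCoeff‖ * r₂ ^ p.natDegree)
          - characteristic f ⊤ (‖p.leadingCoeff‖ * r₁ ^ p.natDegree)
        ≤ (1 + ε) * (characteristic (fun z => f (p.eval z)) ⊤ (r₂ + K)
          - characteristic (fun z => f (p.eval z)) ⊤ (r₁ + K)) := by
  have hp0 : p ≠ 0 := by rintro rfl; simp at hp
  have hc : 0 < ‖p.leadingCoeff‖ := by simpa using hp0
  have h₂ : 0 < r₂ := h₁.trans_le h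
  have hfp := hf.comp_polynomial p
  have hint : ∀ {g : ℂ → ℂ}, Meromorphic g → ∀ s t : ℝ,
      CircleIntegrable (fun a : ℂ => logCounting g a s - logCounting g a t) 0 1 :=
    fun hg s t => (circleIntegrable_logCounting hg).sub (circleIntegrable_logCounting hg)
  rw [characteristic_sub_characteristic_eq_circleAverage hfp h₁.ne' h₂.ne',
    characteristic_sub_characteristic_eq_circleAverage hfp (by positivity) (by positivity),
    characteristic_sub_characteristic_eq_circleAverage hf (by positivity) (by positivity),
    characteristic_sub_characteristic_eq_circleAverage hf (by positivity) (by positivity),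
    ← smul_eq_mul (1 + ε), ← smul_eq_mul (1 + ε), ← Real.circleAverage_fun_smul,
    ← Real.circleAverage_fun_smul]
  have hb := fun a : ℂ => logCounting_comp_polynomial_bounds hf p hp hK0 hK (hfc a) h₁ h hε hKr
  exact ⟨Real.circleAverage_mono (hint hfp _ _) ((hint hf _ _).const_smul (a := 1 + ε))
      fun a _ => (hb a).1,
    Real.circleAverage_mono (hint hf _ _) ((hint hfp _ _).const_smul (a := 1 + ε))
      fun a _ => (hb a).2⟩

/-- By the first main theorem, a single `a`-point `z₀` already forces `T(r, f) ≥ log r - O(1)`. -/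
theorem ValueDistribution.tendsto_characteristic_atTop {f : ℂ → ℂ} (hf : Meromorphic f)
    (hfc : ∀ a z, meromorphicOrderAt (f · - a) z ≠ ⊤) :
    Tendsto (characteristic f ⊤) atTop atTop := by
  classical
  obtain ⟨z₀, hz₀⟩ : ∃ z₀, AnalyticAt ℂ f z₀ :=
    ((hf 0).eventually_analyticAt).exists
  set a := f z₀
  have hfa : Meromorphic (f · - a) := fun z => (hf z).fun_sub (MeromorphicAt.const a z)
  have hord : 1 ≤ MeromorphicOn.divisor (f · - a) Set.univ z₀ := by
    rw [MeromorphicOn.divisor_apply hfa.meromorphicOn (Set.mem_univ _)]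
    have han : AnalyticAt ℂ (f · - a) z₀ := hz₀.fun_sub analyticAt_const
    have hne : analyticOrderAt (f · - a) z₀ ≠ 0 := by
      rw [han.analyticOrderAt_ne_zero]; simp [a]
    have htop := hfc a z₀
    rw [han.meromorphicOrderAt_eq] at htop ⊢
    have htop' : analyticOrderAt (f · - a) z₀ ≠ ⊤ := by rintro h; simp [h] at htop
    lift analyticOrderAt (f · - a) z₀ to ℕ using htop' with m hm
    have : m ≠ 0 := by rintro rfl; simp at hne
    change (1 : ℤ) ≤ (m : ℤ)
    omega
  have hsingle : locallyFinsuppWithin.single z₀ 1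
      ≤ (MeromorphicOn.divisor (f · - a) Set.univ)⁺ := by
    intro z
    by_cases hz : z = z₀
    · subst hz
      rw [locallyFinsuppWithin.posPart_apply]
      simpa [locallyFinsuppWithin.single_apply] using hord.trans (le_posPart _)
    · rw [locallyFinsuppWithin.posPart_apply]
      simp [locallyFinsuppWithin.single_apply, hz, posPart_nonneg]
  set B := |Real.log ‖meromorphicTrailingCoeffAt (f · - a) 0‖| + (Real.posLog ‖a‖ + Real.log 2)
  have hlog : Tendsto (fun r : ℝ => Real.log r - (Real.log ‖z₀‖ + B)) atTop atTop :=
    tendsto_atTop_add_const_right _ _ Real.tendsto_log_atTop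
  refine tendsto_atTop_mono' _ ?_ hlog
  filter_upwards [eventually_ge_atTop 1, eventually_ge_atTop ‖z₀‖] with r hr hrz
  have e1 := abs_le.1 (abs_characteristic_sub_characteristic_shift_le (a₀ := a) (r := r) hf)
  have e2 := characteristic_sub_characteristic_inv_of_ne_zero hfa (R := r) (by positivity)
  have e3 : logCounting (f · - a)⁻¹ ⊤ r ≤ characteristic (f · - a)⁻¹ ⊤ r := by
    have := proximity_nonneg (f := (f · - a)⁻¹) (a := ⊤) r
    simp only [characteristic, Pi.add_apply]
    simpa using this
  rw [logCounting_inv, logCounting_zero] at e3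
  have e4 := locallyFinsuppWithin.logCounting_le hsingle hr
  rw [locallyFinsuppWithin.logCounting_single_eq_log_sub_const hrz] at e4
  have e5 := neg_abs_le (Real.log ‖meromorphicTrailingCoeffAt (f · - a) 0‖)
  have e6 := e1.1
  push_cast at e4
  simp only [B]
  linarith

end Characteristic

/-! ### Increments of slowly growing monotone functions -/

section Growth

open MeasureTheory Set

/-- The two shifted integrals cancel except over intervals of length `2C` at the ends; the one at
`a` enters with a favourable sign. -/
theorem Monotone.integral_shift_sub_shift_le {g : ℝ → ℝ} (hg : Monotone g) (hg0 : ∀ t, 0 ≤ g t)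
    {C : ℝ} (hC : 0 ≤ C) (a b : ℝ) :
    ∫ t in a..b, (g (t + C) - g (t - C)) ≤ 2 * C * g (b + C) := by
  have hi : ∀ x y, IntervalIntegrable g volume x y := fun x y => hg.intervalIntegrable
  have h1 : IntervalIntegrable (fun t => g (t + C)) volume a b :=
    (hg.comp fun x y h => by simpa using h).intervalIntegrable
  have h2 : IntervalIntegrable (fun t => g (t - C)) volume a b :=
    (hg.comp fun x y h => by simpa using h).intervalIntegrable
  rw [intervalIntegral.integral_sub h1 h2, intervalIntegral.integral_comp_add_right,
    intervalIntegral.integral_comp_sub_right,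
    intervalIntegral.integral_interval_sub_interval_comm' (hi _ _) (hi _ _) (hi _ _)]
  have h3 : 0 ≤ ∫ t in (a - C)..(a + C), g t :=
    intervalIntegral.integral_nonneg (by linarith) fun t _ => hg0 t
  have h4 : ∫ t in (b - C)..(b + C), g t ≤ ∫ t in (b - C)..(b + C), g (b + C) :=
    intervalIntegral.integral_mono_on (by linarith) (hi _ _) (by simp) fun t ht => hg ht.2
  rw [intervalIntegral.integral_const, smul_eq_mul] at h4
  linarith

/-- A monotone function of order less than one has vanishing increments over intervals of bounded
length, outside of a set of finite logarithmic measure. -/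
theorem Monotone.exists_finiteLogMeasure_tendsto_shift_sub_shift {g : ℝ → ℝ} (hg : Monotone g)
    (hg0 : ∀ t, 0 ≤ g t) {κ M r₀ C : ℝ} (hκ : κ < 1) (hM : 0 ≤ M) (hC : 0 < C)
    (hgκ : ∀ t, r₀ ≤ t → g t ≤ M * t ^ κ) :
    ∃ E : Set ℝ, FiniteLogMeasure E ∧
      Tendsto (fun t => g (t + C) - g (t - C)) (atTop ⊓ 𝓟 Eᶜ) (𝓝 0) := by
  -- Chosen so that `κ + δ - 1 = -δ`: on `[X, 2X]`, Chebyshev's inequality bounds the logarithmic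
  -- measure of `{h ≥ t ^ (-δ)}` by a multiple of `X ^ (-δ)`, which is summable over dyadic `X`.
  set δ := (1 - κ) / 2 with hδ
  have hδ0 : 0 < δ := by rw [hδ]; linarith
  set h := fun t => g (t + C) - g (t - C) with hh
  have hh0 : ∀ t, 0 ≤ h t := fun t => sub_nonneg.2 (hg (by linarith))
  have hhm : Measurable h :=
    (hg.measurable.comp (measurable_add_const C)).sub (hg.measurable.comp (measurable_sub_const C))
  -- Dyadic blocks start beyond `C` and `r₀`, so `2X + C ≤ 3X` and the growth bound applies at `3X`.
  obtain ⟨N, hN⟩ := pow_unbounded_of_one_lt (max r₀ C) (one_lt_two (α := ℝ))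
  set E : Set ℝ := {t | 2 ^ N < t ∧ 1 ≤ h t * t ^ δ} with hE
  have hEm : MeasurableSet E :=
    measurableSet_Ioi.inter
      (measurableSet_le measurable_const (hhm.mul (measurable_id.pow_const δ)))
  refine ⟨E, ⟨hEm, ?_⟩, ?_⟩
  · set q : ℝ := 2 ^ (-δ) with hq
    have hq0 : 0 < q := by positivity
    have hq1 : q < 1 := Real.rpow_lt_one_of_one_lt_of_neg one_lt_two (by linarith)
    set S : ℕ → Set ℝ := fun k => Icc (2 ^ (N + k)) (2 * 2 ^ (N + k)) with hS
    have hcover : E ∩ Ici 1 ⊆ ⋃ k, S k ∩ E := by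
      rintro t ⟨htE, -⟩
      have ht0 : (0 : ℝ) < t := lt_trans (by positivity) htE.1
      obtain ⟨k, hk1, hk2⟩ := exists_nat_pow_near (x := t / 2 ^ N) (y := 2)
        ((one_lt_div (by positivity)).2 htE.1).le one_lt_two
      refine mem_iUnion.2 ⟨k, ⟨?_, ?_⟩, htE⟩
      · rw [le_div_iff₀ (by positivity)] at hk1
        rw [pow_add]; linarith
      · rw [div_lt_iff₀ (by positivity)] at hk2
        rw [pow_succ] at hk2
        rw [pow_add]; linarith
    have hpiece : ∀ k, ∫⁻ t in S k ∩ E, ENNReal.ofReal (1 / t)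
        ≤ ENNReal.ofReal (6 * C * M * q ^ k) := by
      intro k
      set X : ℝ := 2 ^ (N + k) with hX
      have hX0 : 0 < X := by positivity
      have hNX : (2 : ℝ) ^ N ≤ X := pow_le_pow_right₀ one_le_two (by omega)
      have hkX : (2 : ℝ) ^ k ≤ X := pow_le_pow_right₀ one_le_two (by omega)
      have hXr : r₀ ≤ X := (le_max_left _ _).trans (hN.le.trans hNX)
      have hXC : C ≤ X := (le_max_right _ _).trans (hN.le.trans hNX)
      have hint : IntegrableOn h (Icc X (2 * X)) := by
        rw [← intervalIntegrable_iff_integrableOn_Icc_of_le (by linarith)]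
        exact IntervalIntegrable.sub
          (hg.comp fun x y h => by simpa using h).intervalIntegrable
          (hg.comp fun x y h => by simpa using h).intervalIntegrable
      have hbound : ∫ t in Icc X (2 * X), h t ≤ 2 * C * (M * (3 * X) ^ κ) := by
        rw [integral_Icc_eq_integral_Ioc, ← intervalIntegral.integral_of_le (by linarith)]
        refine (hg.integral_shift_sub_shift_le hg0 hC.le _ _).trans ?_
        refine mul_le_mul_of_nonneg_left ?_ (by linarith)
        exact (hg (by linarith)).trans (hgκ _ (by linarith))
      calc ∫⁻ t in S k ∩ E, ENNReal.ofReal (1 / t)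
          ≤ ∫⁻ t in S k ∩ E, ENNReal.ofReal (h t * ((3 * X) ^ δ / X)) := by
            refine setLIntegral_mono (by fun_prop) fun t ht => ENNReal.ofReal_le_ofReal ?_
            obtain ⟨⟨ht1, ht2⟩, -, htE⟩ := ht
            have ht0 : 0 < t := hX0.trans_le ht1
            have : t ^ δ ≤ (3 * X) ^ δ := Real.rpow_le_rpow ht0.le (by linarith) hδ0.le
            rw [← mul_div_assoc]
            refine div_le_div₀ (mul_nonneg (hh0 t) (by positivity)) ?_ hX0 ht1
            exact htE.trans (mul_le_mul_of_nonneg_left this (hh0 t))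
        _ ≤ ∫⁻ t in Icc X (2 * X), ENNReal.ofReal (h t * ((3 * X) ^ δ / X)) :=
            lintegral_mono_set inter_subset_left
        _ = ENNReal.ofReal (∫ t in Icc X (2 * X), h t * ((3 * X) ^ δ / X)) :=
            (ofReal_integral_eq_lintegral_ofReal (hint.mul_const _)
              (Eventually.of_forall fun t => mul_nonneg (hh0 t) (by positivity))).symm
        _ ≤ ENNReal.ofReal (6 * C * M * q ^ k) := by
            refine ENNReal.ofReal_le_ofReal ?_
            rw [integral_mul_const]
            refine (mul_le_mul_of_nonneg_right hbound (by positivity)).trans ?_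
            have e1 : (3 * X) ^ κ * (3 * X) ^ δ = (3 * X) ^ (-δ) * (3 * X) := by
              rw [← Real.rpow_add (by positivity)]
              conv_rhs => rw [← Real.rpow_one (3 * X), ← Real.rpow_mul (by positivity),
                ← Real.rpow_add (by positivity)]
              congr 1
              rw [hδ]; ring
            have e2 : (3 * X) ^ (-δ) ≤ q ^ k := by
              have e3 : q ^ k = ((2 : ℝ) ^ k) ^ (-δ) := by
                rw [hq, ← Real.rpow_natCast, ← Real.rpow_mul zero_le_two, mul_comm,
                  Real.rpow_mul zero_le_two, Real.rpow_natCast]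
              rw [e3]
              exact Real.rpow_le_rpow_of_nonpos (by positivity) (by linarith) (by linarith)
            calc 2 * C * (M * (3 * X) ^ κ) * ((3 * X) ^ δ / X)
                = 2 * C * M * ((3 * X) ^ κ * (3 * X) ^ δ) / X := by ring
              _ = 6 * C * M * (3 * X) ^ (-δ) := by rw [e1]; field_simp; ring
              _ ≤ 6 * C * M * q ^ k := by gcongr
    calc ∫⁻ t in E ∩ Ici 1, ENNReal.ofReal (1 / t)
        ≤ ∫⁻ t in ⋃ k, S k ∩ E, ENNReal.ofReal (1 / t) := lintegral_mono_set hcover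
      _ ≤ ∑' k, ∫⁻ t in S k ∩ E, ENNReal.ofReal (1 / t) := lintegral_iUnion_le _ _
      _ ≤ ∑' k, ENNReal.ofReal (6 * C * M * q ^ k) := ENNReal.tsum_le_tsum hpiece
      _ = ENNReal.ofReal (∑' k, 6 * C * M * q ^ k) :=
          (ENNReal.ofReal_tsum_of_nonneg (fun k => by positivity)
            ((summable_geometric_of_lt_one hq0.le hq1).mul_left _)).symm
      _ < ⊤ := ENNReal.ofReal_lt_top
  · refine squeeze_zero' (Eventually.of_forall hh0) (g := fun t => t ^ (-δ)) ?_
      ((tendsto_rpow_neg_atTop hδ0).mono_left inf_le_left)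
    filter_upwards [mem_inf_of_right (mem_principal_self Eᶜ),
      mem_inf_of_left (Ioi_mem_atTop ((2 : ℝ) ^ N))] with t htE ht
    have ht0 : (0 : ℝ) < t := lt_trans (by positivity) ht
    have : h t * t ^ δ < 1 := not_le.1 fun h' => htE ⟨ht, h'⟩
    rw [Real.rpow_neg ht0.le, ← one_div, le_div_iff₀ (by positivity)]
    exact this.le

end Growth

/-! ### Hyper-order, the squeeze, and the constant case -/

section Main

open Polynomial ValueDistribution

theorem exists_eventually_posLog_nevanlinnaT_le {f : ℂ → ℂ} {b : ℝ} (hb : 0 < b)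
    (h : hyperOrder f < (b : EReal)) :
    ∃ ρ : ℝ, 0 ≤ ρ ∧ ρ < b ∧ ∀ᶠ r in atTop, Real.posLog (nevanlinnaT r f) ≤ r ^ ρ := by
  obtain ⟨ρ, h1, h2⟩ := EReal.lt_iff_exists_real_btwn.1 h
  have h2' : ρ < b := by exact_mod_cast h2
  refine ⟨max ρ 0, le_max_right _ _, max_lt h2' hb, ?_⟩
  filter_upwards [eventually_lt_of_limsup_lt h1, eventually_gt_atTop 1] with r hr hr1
  have hlog : 0 < Real.log r := Real.log_pos hr1
  have hr' : Real.posLog (Real.posLog (nevanlinnaT r f)) ≤ max ρ 0 * Real.log r := by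
    rw [← div_le_iff₀ hlog]
    exact le_max_of_le_left (by exact_mod_cast hr.le)
  rcases (Real.posLog_nonneg (x := nevanlinnaT r f)).eq_or_lt with h0 | h0
  · rw [← h0]; positivity
  calc Real.posLog (nevanlinnaT r f) = Real.exp (Real.log (Real.posLog (nevanlinnaT r f))) :=
        (Real.exp_log h0).symm
    _ ≤ Real.exp (max ρ 0 * Real.log r) :=
        Real.exp_le_exp.2 ((le_max_right _ _).trans hr')
    _ = r ^ max ρ 0 := by rw [Real.rpow_def_of_pos (by linarith), mul_comm]

/-- Two functions whose growths dominate each other up to bounded shifts are asymptotic to each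
other wherever one of them is asymptotically invariant under these shifts. -/
theorem tendsto_div_of_shift_bounds {S U : ℝ → ℝ} {F : Filter ℝ} (hF : F ≤ atTop) {C : ℝ}
    (hC : 0 < C) (hS : Tendsto S atTop atTop) (hSmono : MonotoneOn S (Set.Ioi 0))
    (hup : ∀ r₁ r₂ ε, 0 < r₁ → r₁ ≤ r₂ → 0 ≤ ε → C ≤ ε * r₁ →
      U r₂ - U r₁ ≤ (1 + ε) * (S (r₂ + C) - S (r₁ + C)))
    (hlow : ∀ r₁ r₂ ε, 0 < r₁ → r₁ ≤ r₂ → 0 ≤ ε → C ≤ ε * r₁ →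
      S r₂ - S r₁ ≤ (1 + ε) * (U (r₂ + C) - U (r₁ + C)))
    (hg : Tendsto (fun t => Real.log (S (t + C)) - Real.log (S (t - C))) F (𝓝 0)) :
    Tendsto (fun r => U r / S r) F (𝓝 1) := by
  have hpC : Tendsto (fun t : ℝ => t + C) atTop atTop := tendsto_atTop_add_const_right _ _ tendsto_id
  have hmC : Tendsto (fun t : ℝ => t - C) atTop atTop :=
    tendsto_atTop_add_const_right _ (-C) tendsto_id
  have hpos : ∀ᶠ r in F, 0 < S r ∧ 0 < S (r + C) ∧ 0 < S (r - C) ∧ C < r := hF <| by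
    filter_upwards [hS.eventually_gt_atTop 0, (hS.comp hpC).eventually_gt_atTop 0,
      (hS.comp hmC).eventually_gt_atTop 0, eventually_gt_atTop C] with r h1 h2 h3 h4
      using ⟨h1, h2, h3, h4⟩
  have hSF : Tendsto S F atTop := hS.mono_left hF
  have hexp : Tendsto (fun t => S (t + C) / S (t - C)) F (𝓝 1) := by
    have := (Real.continuous_exp.tendsto 0).comp hg
    rw [Real.exp_zero] at this
    refine this.congr' ?_
    filter_upwards [hpos] with r ⟨_, h2, h3, _⟩
    simp only [Function.comp]
    rw [Real.exp_sub, Real.exp_log h2, Real.exp_log h3]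
  have hp1 : Tendsto (fun t => S (t + C) / S t) F (𝓝 1) := by
    refine tendsto_of_tendsto_of_tendsto_of_le_of_le' tendsto_const_nhds hexp ?_ ?_
    · filter_upwards [hpos] with r ⟨h1, h2, h3, h4⟩
      rw [le_div_iff₀ h1, one_mul]
      exact hSmono (hC.trans h4) (Set.mem_Ioi.2 (by linarith)) (by linarith)
    · filter_upwards [hpos] with r ⟨h1, h2, h3, h4⟩
      gcongr
      exact hSmono (Set.mem_Ioi.2 (by linarith)) (hC.trans h4) (by linarith)
  have hm1 : Tendsto (fun t => S (t - C) / S t) F (𝓝 1) := by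
    have hexp' := hexp.inv₀ one_ne_zero
    rw [inv_one] at hexp'
    refine tendsto_of_tendsto_of_tendsto_of_le_of_le' hexp' tendsto_const_nhds ?_ ?_
    · filter_upwards [hpos] with r ⟨h1, h2, h3, h4⟩
      rw [inv_div]
      gcongr
      exact hSmono (hC.trans h4) (Set.mem_Ioi.2 (by linarith)) (by linarith)
    · filter_upwards [hpos] with r ⟨h1, h2, h3, h4⟩
      rw [div_le_one h1]
      exact hSmono (Set.mem_Ioi.2 (by linarith)) (hC.trans h4) (by linarith)
  have hconst : ∀ B : ℝ, Tendsto (fun r => B / S r) F (𝓝 0) := fun B => hSF.const_div_atTop B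
  refine tendsto_order.2 ⟨fun a ha => ?_, fun a ha => ?_⟩
  · obtain ⟨ε, hε, hεa⟩ : ∃ ε : ℝ, 0 < ε ∧ a < (1 + ε)⁻¹ := by
      have : Tendsto (fun ε : ℝ => (1 + ε)⁻¹) (𝓝[>] 0) (𝓝 1) := by
        have : ContinuousAt (fun ε : ℝ => (1 + ε)⁻¹) 0 :=
          ContinuousAt.inv₀ (by fun_prop) (by norm_num)
        have := this.tendsto.mono_left (nhdsWithin_le_nhds (s := Set.Ioi 0))
        simpa using this
      obtain ⟨ε, h1, h2⟩ := ((this.eventually (lt_mem_nhds ha)).and self_mem_nhdsWithin).exists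
      exact ⟨ε, h2, h1⟩
    -- The least base radius with `C ≤ ε r₁`. It stays fixed as `r → ∞`, so the values at the base
    -- radius are negligible against `S r`.
    set r₁ := C / ε
    have hr₁ : 0 < r₁ := by positivity
    have hCr : C ≤ ε * r₁ := by simp only [r₁]; field_simp; rfl
    have hlim : Tendsto (fun r => (1 + ε)⁻¹ * (S (r - C) / S r)
        + (U (r₁ + C) - (1 + ε)⁻¹ * S r₁) / S r) F (𝓝 ((1 + ε)⁻¹ * 1 + 0)) :=
      (hm1.const_mul _).add (hconst _)
    rw [mul_one, add_zero] at hlim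
    filter_upwards [hlim.eventually (lt_mem_nhds hεa), hpos,
      hF (eventually_ge_atTop (r₁ + C))] with r h1 ⟨h2, _⟩ h3
    refine h1.trans_le ?_
    -- Applied up to `r - C`, so that the shifted right-hand side ends at `U r`.
    have := hlow r₁ (r - C) ε hr₁ (by linarith) hε.le hCr
    rw [sub_add_cancel] at this
    have h5 : (1 + ε)⁻¹ * (S (r - C) - S r₁) ≤ U r - U (r₁ + C) := by
      rw [inv_mul_le_iff₀ (by linarith)]; exact this
    rw [← mul_div_assoc, ← add_div]
    gcongr
    linarith
  · set ε := (a - 1) / 2 with hε'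
    have hε : 0 < ε := by rw [hε']; linarith
    set r₁ := C / ε
    have hr₁ : 0 < r₁ := by positivity
    have hCr : C ≤ ε * r₁ := by simp only [r₁]; field_simp; rfl
    have hlim : Tendsto (fun r => (1 + ε) * (S (r + C) / S r)
        + (U r₁ - (1 + ε) * S (r₁ + C)) / S r) F (𝓝 ((1 + ε) * 1 + 0)) :=
      (hp1.const_mul _).add (hconst _)
    rw [mul_one, add_zero] at hlim
    filter_upwards [hlim.eventually (gt_mem_nhds (show 1 + ε < a by linarith)), hpos,
      hF (eventually_ge_atTop r₁)] with r h1 ⟨h2, _⟩ h3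
    refine lt_of_le_of_lt ?_ h1
    have := hup r₁ r ε hr₁ h3 hε.le hCr
    rw [← mul_div_assoc, ← add_div]
    gcongr
    linarith

theorem Meromorphic.eqOn_codiscrete_const_of_meromorphicOrderAt_eq_top {f : ℂ → ℂ}
    (hf : Meromorphic f) {a z₀ : ℂ} (h : meromorphicOrderAt (f · - a) z₀ = ⊤) :
    f =ᶠ[codiscrete ℂ] fun _ => a := by
  have hfa : Meromorphic (f · - a) := fun z => (hf z).fun_sub (MeromorphicAt.const a z)
  have hall : ∀ z, meromorphicOrderAt (f · - a) z = ⊤ := fun z => by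
    by_contra hz
    exact hfa.meromorphicOn.meromorphicOrderAt_ne_top_of_isPreconnected isPreconnected_univ
      (Set.mem_univ z) (Set.mem_univ z₀) hz h
  refine mem_codiscreteWithin_iff_forall_mem_nhdsNE.2 fun z _ => ?_
  filter_upwards [meromorphicOrderAt_eq_top_iff.1 (hall z)] with w hw
  exact Or.inl (sub_eq_zero.1 hw)

/-- Preimages of codiscrete sets under a nonconstant polynomial are codiscrete, and the
characteristic at nonzero radius ignores changes off a codiscrete set. -/
theorem nevanlinnaT_comp_eval_eq_of_codiscrete_const {f : ℂ → ℂ} {a : ℂ}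
    (h : f =ᶠ[codiscrete ℂ] fun _ => a) (p : ℂ[X]) (hp : 1 ≤ p.natDegree) {r s : ℝ}
    (hr : r ≠ 0) (hs : s ≠ 0) :
    nevanlinnaT r (fun z => f (p.eval z)) = nevanlinnaT s f := by
  have hcomp : (fun z => f (p.eval z)) =ᶠ[codiscrete ℂ] fun _ => a := by
    have := AnalyticOnNhd.preimage_mem_codiscreteWithin (U := Set.univ) (s := {z | f z = a})
      (f := fun z => p.eval z) (fun w _ => p.analyticAt_eval w)
      (fun w _ => p.not_eventuallyConst_eval hp w)
      (codiscreteWithin_mono (Set.subset_univ _) h)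
    exact this
  rw [nevanlinnaT, nevanlinnaT, characteristic_congr_codiscrete h hs,
    characteristic_congr_codiscrete hcomp hr]
  simp [characteristic]

theorem theorem3 (ω : Polynomial ℂ) (n : ℕ) (c : ℂ)
    (hn : ω.natDegree = n) (hc : ω.leadingCoeff = c) (hω : 1 ≤ n)
    (f : ℂ → ℂ) (hf : Meromorphic f)
    (hord : hyperOrder f < ((1 / (n : ℝ) ^ 2 : ℝ) : EReal)) :
    ∃ E : Set ℝ, FiniteLogMeasure E ∧
      ∃ ε : ℝ → ℝ, Tendsto ε (atTop ⊓ 𝓟 Eᶜ) (𝓝 0) ∧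
        ∀ᶠ r : ℝ in atTop ⊓ 𝓟 Eᶜ,
          nevanlinnaT r (fun z => f (ω.eval z)) =
            (1 + ε r) * nevanlinnaT (‖c‖ * r ^ n) f := by
  subst hn hc
  set n := ω.natDegree
  have hω0 : ω ≠ 0 := by rintro rfl; simp [n] at hω
  have hc : 0 < ‖ω.leadingCoeff‖ := by simpa using hω0
  set k := ‖ω.leadingCoeff‖
  by_cases hfc : ∀ a z, meromorphicOrderAt (f · - a) z ≠ ⊤
  · obtain ⟨C, hC, hCω⟩ := ω.exists_abs_norm_sub_le hω
    obtain ⟨ρ, hρ0, hρ, hρT⟩ := exists_eventually_posLog_nevanlinnaT_le (by positivity) hord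
    have hn1 : (1 : ℝ) ≤ n := by exact_mod_cast hω
    -- `T(R, f) ≤ exp (R ^ ρ)` at `R = k r ^ n` gives `log S` order at most `n ρ`; here `n ρ ≤ n ^ 2
    -- ρ < 1`.
    have hκ : n * ρ < 1 := by
      rw [lt_div_iff₀ (by positivity)] at hρ
      nlinarith
    have hR : Tendsto (fun r : ℝ => k * r ^ n) atTop atTop :=
      (tendsto_pow_atTop (by omega)).const_mul_atTop hc
    set S : ℝ → ℝ := fun r => nevanlinnaT (k * r ^ n) f with hSdef
    have hS : Tendsto S atTop atTop := (tendsto_characteristic_atTop hf hfc).comp hR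
    have hSmono : MonotoneOn S (Set.Ioi 0) := fun x hx y hy hxy =>
      characteristic_monotoneOn hf (Set.mem_Ioi.2 (mul_pos hc (pow_pos hx n)))
        (Set.mem_Ioi.2 (mul_pos hc (pow_pos hy n)))
        (mul_le_mul_of_nonneg_left (pow_le_pow_left₀ (le_of_lt hx) hxy n) hc.le)
    -- The truncations make `log S` monotone and nonnegative on all of `ℝ` without changing it for
    -- large `t`.
    set g : ℝ → ℝ := fun t => Real.log (max 1 (S (max t 1))) with hgdef
    have hpos1 : ∀ t : ℝ, max t 1 ∈ Set.Ioi (0 : ℝ) := fun t =>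
      Set.mem_Ioi.2 (lt_max_of_lt_right one_pos)
    have hg : Monotone g := by
      intro x y hxy
      exact Real.log_le_log (lt_max_of_lt_left one_pos)
        (max_le_max_left _ (hSmono (hpos1 x) (hpos1 y) (max_le_max_right _ hxy)))
    obtain ⟨r₀, hr₀⟩ := eventually_atTop.1 ((hR.eventually hρT).and (eventually_ge_atTop 1))
    obtain ⟨E, hE, hEg⟩ := hg.exists_finiteLogMeasure_tendsto_shift_sub_shift
      (fun t => Real.log_nonneg (le_max_left _ _)) (κ := n * ρ) (M := k ^ ρ) (r₀ := r₀) hκ (by positivity) hC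
      (fun t ht => by
        obtain ⟨h1, h2⟩ := hr₀ t ht
        simp only [hgdef, max_eq_left h2, hSdef]
        have h3 : Real.log (max 1 (nevanlinnaT (k * t ^ n) f))
            ≤ Real.posLog (nevanlinnaT (k * t ^ n) f) := by
          rcases le_total (nevanlinnaT (k * t ^ n) f) 1 with h | h
          · rw [max_eq_left h, Real.log_one]
            exact Real.posLog_nonneg
          · rw [max_eq_right h, Real.posLog_eq_log (h.trans (le_abs_self _))]
        refine (h3.trans h1).trans (le_of_eq ?_)
        rw [Real.mul_rpow hc.le (by positivity), Real.rpow_mul (by positivity),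
          Real.rpow_natCast])
    refine ⟨E, hE, fun r => nevanlinnaT r (fun z => f (ω.eval z)) / S r - 1, ?_, ?_⟩
    · have hbounds := fun r₁ r₂ ε h₁ h hε hKr =>
        characteristic_comp_polynomial_bounds hf hfc ω hω hC hCω (r₁ := r₁) (r₂ := r₂) (ε := ε)
          h₁ h hε hKr
      have hlim := tendsto_div_of_shift_bounds (F := atTop ⊓ 𝓟 Eᶜ)
        (U := fun r => nevanlinnaT r (fun z => f (ω.eval z))) inf_le_left hC hS hSmono
        (fun r₁ r₂ ε h₁ h hε hKr => (hbounds r₁ r₂ ε h₁ h hε hKr).1)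
        (fun r₁ r₂ ε h₁ h hε hKr => (hbounds r₁ r₂ ε h₁ h hε hKr).2)
        (hEg.congr' (by
          have hlog : ∀ᶠ t in atTop, g t = Real.log (S t) := by
            filter_upwards [hS.eventually_ge_atTop 1, eventually_ge_atTop 1] with t h1 h2
            simp only [hgdef, max_eq_left h2, max_eq_right h1]
          have hp := (tendsto_atTop_add_const_right _ C tendsto_id).eventually hlog
          have hm := (tendsto_atTop_add_const_right _ (-C) tendsto_id).eventually hlog
          filter_upwards [mem_inf_of_left hp, mem_inf_of_left hm] with t h1 h2
          simp only [id, ← sub_eq_add_neg] at h1 h2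
          rw [h1, h2]))
      simpa using hlim.sub_const 1
    · filter_upwards [mem_inf_of_left (hS.eventually_gt_atTop 0)] with r hr
      rw [add_sub_cancel, div_mul_cancel₀ _ (ne_of_gt hr)]
  · push Not at hfc
    obtain ⟨a, z, haz⟩ := hfc
    have hconst := hf.eqOn_codiscrete_const_of_meromorphicOrderAt_eq_top haz
    refine ⟨∅, ⟨MeasurableSet.empty, by simp⟩, fun _ => 0, tendsto_const_nhds, ?_⟩
    filter_upwards [mem_inf_of_left (eventually_gt_atTop 0)] with r hr
    rw [add_zero, one_mul]
    exact nevanlinnaT_comp_eval_eq_of_codiscrete_const hconst ω hω (ne_of_gt hr) (by positivity)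

end Main
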